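/- For an integer $q\ge 1$ let $e_0,\dots,e_q$ be the standard basis of $\mathbb{C}^{q+1}$ and let \[ T_{cw,q}=\sum_{j=1}^{q}\bigl(e_0\otimes e_j\otimes e_j+e_j\otimes e_0\otimes e_j+e_j\otimes e_j\otimes e_0\bigr)\in(\mathbb{C}^{q+1})^{\otimes 3} \] be the little Coppersmith–Winograd tensor. For finite-dimensional complex vector spaces $A,B,C$ and $T\in A\otimes B\otimes C$, the rank $\mathbf{R}(T)$ is the least $r$ such that $T$ is a sum of $r$ simple tensors $x\otimes y\otimes z$, and the border rank $\underline{\mathbf R}(T)$ is the least $r$ such that $T$ is the limit, in the Euclidean topology, of a sequence of tensors of rank at most $r$. The Kronecker product of $T\in A\otimes B\otimes C$ and $S\in A'\otimes B'\otimes C'$ is the tensor $T\boxtimes S\in (A\otimes A')\otimes(B\otimes B')\otimes(C\otimes C')$ obtained by bilinear extension from \[ (a\otimes b\otimes c)\boxtimes(a'\otimes b'\otimes c')=(a\otimes a')\otimes(b\otimes b')\otimes(c\otimes c'), \] and $T^{\boxtimes 2}=T\boxtimes T$. **Theorem.** For every integer $q\ge 3$, \[ \underline{\mathbf R}\bigl(T_{cw,q}^{\boxtimes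 2}\bigr)=(q+2)^2 . \] -/

import Mathlib

open scoped TensorProduct

namespace BorderRank

section General

variable {A B C A' B' C' : Type*}
  [AddCommGroup A] [Module ℂ A] [AddCommGroup B] [Module ℂ B] [AddCommGroup C] [Module ℂ C]
  [AddCommGroup A'] [Module ℂ A'] [AddCommGroup B'] [Module ℂ B'] [AddCommGroup C'] [Module ℂ C']

/-- `T` is a sum of `r` simple tensors `x ⊗ y ⊗ z` (some of which may vanish). -/
def IsSumOfSimple (T : A ⊗[ℂ] B ⊗[ℂ] C) (r : ℕ) : Prop :=
  ∃ (x : Fin r → A) (y : Fin r → B) (z : Fin r → C), T = ∑ l, x l ⊗ₜ[ℂ] y l ⊗ₜ[ℂ] z l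

/-- Every tensor is a finite sum of simple tensors, so the minimum in `tensorRank` is attained. -/
theorem exists_isSumOfSimple (T : A ⊗[ℂ] B ⊗[ℂ] C) : ∃ r, IsSumOfSimple T r := by
  have add : ∀ S S' : A ⊗[ℂ] B ⊗[ℂ] C, (∃ r, IsSumOfSimple S r) → (∃ r, IsSumOfSimple S' r) →
      ∃ r, IsSumOfSimple (S + S') r := by
    rintro S S' ⟨r, x, y, z, h⟩ ⟨r', x', y', z', h'⟩
    refine ⟨r + r', Fin.append x x', Fin.append y y', Fin.append z z', ?_⟩
    simp [Fin.sum_univ_add, h, h']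
  induction T using TensorProduct.induction_on with
  | zero => exact ⟨0, 0, 0, 0, by simp⟩
  | tmul u c =>
    induction u using TensorProduct.induction_on with
    | zero => exact ⟨0, 0, 0, 0, by simp⟩
    | tmul a b => exact ⟨1, fun _ => a, fun _ => b, fun _ => c, by simp⟩
    | add u v hu hv => rw [TensorProduct.add_tmul]; exact add _ _ hu hv
  | add S S' hS hS' => exact add _ _ hS hS'

/-- The tensor rank: the least number of simple tensors summing to `T`. -/
noncomputable def tensorRank (T : A ⊗[ℂ] B ⊗[ℂ] C) : ℕ :=
  sInf {r | IsSumOfSimple T r}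

/-- `T` is the limit of a sequence of tensors of rank at most `r`. The limit is taken in the
module topology over `ℂ`, which on a finite-dimensional space is the Euclidean topology. -/
def IsLimitOfRankLE (T : A ⊗[ℂ] B ⊗[ℂ] C) (r : ℕ) : Prop :=
  ∃ t : ℕ → A ⊗[ℂ] B ⊗[ℂ] C, (∀ m, tensorRank (t m) ≤ r) ∧
    Filter.Tendsto t Filter.atTop (@nhds _ (moduleTopology ℂ (A ⊗[ℂ] B ⊗[ℂ] C)) T)

/-- The constant sequence shows that the minimum in `borderRank` is attained. -/
theorem isLimitOfRankLE_tensorRank (T : A ⊗[ℂ] B ⊗[ℂ] C) : IsLimitOfRankLE T (tensorRank T) :=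
  ⟨fun _ => T, fun _ => le_rfl, by
    letI := moduleTopology ℂ (A ⊗[ℂ] B ⊗[ℂ] C)
    exact tendsto_const_nhds⟩

/-- The border rank: the least `r` such that `T` is a limit of tensors of rank at most `r`. -/
noncomputable def borderRank (T : A ⊗[ℂ] B ⊗[ℂ] C) : ℕ :=
  sInf {r | IsLimitOfRankLE T r}

/-- The Kronecker product of two tensors of order three: the tensor product `T ⊗ S` with the
factors regrouped, regarded again as a tensor of order three. It is determined by bilinearity
and its value on simple tensors, see `kronecker_tmul`. -/
noncomputable def kronecker (T : A ⊗[ℂ] B ⊗[ℂ] C) (S : A' ⊗[ℂ] B' ⊗[ℂ] C') :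
    (A ⊗[ℂ] A') ⊗[ℂ] (B ⊗[ℂ] B') ⊗[ℂ] (C ⊗[ℂ] C') :=
  (TensorProduct.tensorTensorTensorComm ℂ A B A' B').toLinearMap.rTensor (C ⊗[ℂ] C')
    (TensorProduct.tensorTensorTensorComm ℂ (A ⊗[ℂ] B) C (A' ⊗[ℂ] B') C' (T ⊗ₜ[ℂ] S))

theorem kronecker_tmul (a : A) (b : B) (c : C) (a' : A') (b' : B') (c' : C') :
    kronecker (a ⊗ₜ[ℂ] b ⊗ₜ[ℂ] c) (a' ⊗ₜ[ℂ] b' ⊗ₜ[ℂ] c') =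
      (a ⊗ₜ[ℂ] a') ⊗ₜ[ℂ] (b ⊗ₜ[ℂ] b') ⊗ₜ[ℂ] (c ⊗ₜ[ℂ] c') := by
  simp [kronecker]

end General

/-- The standard basis vector `e i` of `ℂ^(q+1)`, for `i = 0, …, q`. -/
def e {q : ℕ} (i : Fin (q + 1)) : Fin (q + 1) → ℂ := Pi.single i 1

/-- The little Coppersmith–Winograd tensor; `j : Fin q` stands for the index `j + 1`, so
`e j.succ` runs through `e 1, …, e q`. -/
noncomputable def littleCW (q : ℕ) :
    (Fin (q + 1) → ℂ) ⊗[ℂ] (Fin (q + 1) → ℂ) ⊗[ℂ] (Fin (q + 1) → ℂ) :=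
  ∑ j : Fin q,
    (e 0 ⊗ₜ[ℂ] e j.succ ⊗ₜ[ℂ] e j.succ + e j.succ ⊗ₜ[ℂ] e 0 ⊗ₜ[ℂ] e j.succ +
      e j.succ ⊗ₜ[ℂ] e j.succ ⊗ₜ[ℂ] e 0)

end BorderRank

namespace BorderRank

/-! Upper bound: `littleCW_approx` writes the little Coppersmith–Winograd tensor as a limit of sums
of `q + 2` cubes. The Kronecker product is bilinear, hence continuous, and multiplies numbers of
summands, so the square has border rank at most `(q + 2) ^ 2`.

Lower bound: project the first factor of the square to `ℂ⁵` and form the Koszul flattening `Λ²ℂ⁵ ⊗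
B* → Λ³ℂ⁵ ⊗ C`. A simple tensor has flattening of rank at most `6 = C(4,2)`, and vanishing of a
minor passes to limits, so a nonzero minor of size `N` forces `N ≤ 6 * borderRank`
(`card_le_of_det_flattening_ne_zero`). It remains to find a nonzero minor of size `6 * (q + 2) ^ 2`.

The projection kills `e a ⊗ e a'` as soon as `a` or `a'` is at least `4`. An index `b ≥ 4` in the
second tensor factor can then only meet the same index in the third, with `e 0` in the first. With
`w = q - 3`, the chosen submatrix is therefore block diagonal, with `(w + 1) ^ 2` blocks of only
four shapes, independent of `q`. Explicit pivots make each shape triangular with nonzero diagonal, a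
finite check (`pairwise_pivots`, `forall_mem_pivots`). The block sizes `150`, `30`, `30`, `6` add up
to `150 + 60 w + 6 w ^ 2 = 6 (w + 5) ^ 2`. -/

theorem tendsto_bilin_self {V W : Type*} [AddCommGroup V] [Module ℂ V] [Module.Finite ℂ V]
    [AddCommGroup W] [Module ℂ W] (f : V →ₗ[ℂ] V →ₗ[ℂ] W) {s : ℕ → V} {v : V}
    (h : Filter.Tendsto s Filter.atTop (@nhds _ (moduleTopology ℂ V) v)) :
    Filter.Tendsto (fun m => f (s m) (s m)) Filter.atTop
      (@nhds _ (moduleTopology ℂ W) (f v v)) := by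
  let _ : TopologicalSpace V := moduleTopology ℂ V
  let _ : TopologicalSpace W := moduleTopology ℂ W
  have : IsModuleTopology ℂ V := ⟨rfl⟩
  have : IsModuleTopology ℂ W := ⟨rfl⟩
  have hc := IsModuleTopology.continuous_bilinear_of_finite_left f
  exact (hc.tendsto (v, v)).comp (h.prodMk_nhds h)

/-! ### Upper bound for the border rank of the square -/

section RankBounds

variable {A B C A' B' C' : Type*}
  [AddCommGroup A] [Module ℂ A] [AddCommGroup B] [Module ℂ B] [AddCommGroup C] [Module ℂ C]
  [AddCommGroup A'] [Module ℂ A'] [AddCommGroup B'] [Module ℂ B'] [AddCommGroup C'] [Module ℂ C']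

theorem tensorRank_sum_le {ι : Type*} [Fintype ι] (x : ι → A) (y : ι → B) (z : ι → C) :
    tensorRank (∑ i, x i ⊗ₜ[ℂ] y i ⊗ₜ[ℂ] z i) ≤ Fintype.card ι := by
  refine Nat.sInf_le ⟨x ∘ (Fintype.equivFin ι).symm, y ∘ (Fintype.equivFin ι).symm,
    z ∘ (Fintype.equivFin ι).symm, ?_⟩
  exact (Equiv.sum_comp (Fintype.equivFin ι).symm
    fun i => x i ⊗ₜ[ℂ] y i ⊗ₜ[ℂ] z i).symm

theorem isSumOfSimple_tensorRank (T : A ⊗[ℂ] B ⊗[ℂ] C) : IsSumOfSimple T (tensorRank T) :=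
  Nat.sInf_mem (exists_isSumOfSimple T)

theorem isLimitOfRankLE_borderRank (T : A ⊗[ℂ] B ⊗[ℂ] C) : IsLimitOfRankLE T (borderRank T) :=
  Nat.sInf_mem (s := {r | IsLimitOfRankLE T r}) ⟨_, isLimitOfRankLE_tensorRank T⟩

/-- The Kronecker product as a bilinear map. -/
noncomputable def kroneckerBilin : (A ⊗[ℂ] B ⊗[ℂ] C) →ₗ[ℂ] (A' ⊗[ℂ] B' ⊗[ℂ] C') →ₗ[ℂ]
    (A ⊗[ℂ] A') ⊗[ℂ] (B ⊗[ℂ] B') ⊗[ℂ] (C ⊗[ℂ] C') :=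
  (TensorProduct.mk ℂ (A ⊗[ℂ] B ⊗[ℂ] C) (A' ⊗[ℂ] B' ⊗[ℂ] C')).compr₂
    ((TensorProduct.tensorTensorTensorComm ℂ A B A' B').toLinearMap.rTensor (C ⊗[ℂ] C') ∘ₗ
      (TensorProduct.tensorTensorTensorComm ℂ (A ⊗[ℂ] B) C (A' ⊗[ℂ] B') C').toLinearMap)

theorem kroneckerBilin_apply (T : A ⊗[ℂ] B ⊗[ℂ] C) (S : A' ⊗[ℂ] B' ⊗[ℂ] C') :
    kroneckerBilin T S = kronecker T S := rfl

theorem tensorRank_kronecker_le {ι κ : Type*} [Fintype ι] [Fintype κ]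
    (x : ι → A) (y : ι → B) (z : ι → C) (x' : κ → A') (y' : κ → B') (z' : κ → C') :
    tensorRank (kronecker (∑ i, x i ⊗ₜ[ℂ] y i ⊗ₜ[ℂ] z i) (∑ i, x' i ⊗ₜ[ℂ] y' i ⊗ₜ[ℂ] z' i)) ≤
      Fintype.card ι * Fintype.card κ := by
  rw [← Fintype.card_prod]
  convert tensorRank_sum_le (fun p : ι × κ => x p.1 ⊗ₜ[ℂ] x' p.2) (fun p => y p.1 ⊗ₜ[ℂ] y' p.2)
    (fun p => z p.1 ⊗ₜ[ℂ] z' p.2) using 2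
  simp only [← kroneckerBilin_apply, map_sum, LinearMap.sum_apply, Fintype.sum_prod_type_right]
  simp only [kroneckerBilin_apply, kronecker_tmul]

/-- If `T = lim s m` with each `s m` a sum of `r` simple tensors, then the Kronecker square of `T`
has border rank at most `r ^ 2`. -/
theorem borderRank_kronecker_self_le [Module.Finite ℂ A] [Module.Finite ℂ B] [Module.Finite ℂ C]
    {ι : Type*} [Fintype ι] (T : A ⊗[ℂ] B ⊗[ℂ] C) (x : ℕ → ι → A) (y : ℕ → ι → B) (z : ℕ → ι → C)
    (h : Filter.Tendsto (fun m => ∑ i, x m i ⊗ₜ[ℂ] y m i ⊗ₜ[ℂ] z m i) Filter.atTop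
      (@nhds _ (moduleTopology ℂ (A ⊗[ℂ] B ⊗[ℂ] C)) T)) :
    borderRank (kronecker T T) ≤ Fintype.card ι ^ 2 := by
  refine Nat.sInf_le ⟨fun m => kronecker (∑ i, x m i ⊗ₜ[ℂ] y m i ⊗ₜ[ℂ] z m i)
    (∑ i, x m i ⊗ₜ[ℂ] y m i ⊗ₜ[ℂ] z m i),
    fun m => (tensorRank_kronecker_le _ _ _ _ _ _).trans (sq _).ge, ?_⟩
  exact tendsto_bilin_self (V := A ⊗[ℂ] B ⊗[ℂ] C)
    (W := (A ⊗[ℂ] A) ⊗[ℂ] (B ⊗[ℂ] B) ⊗[ℂ] (C ⊗[ℂ] C)) kroneckerBilin h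

end RankBounds

/-- The coefficients of the simple tensors in `littleCW_approx`. -/
noncomputable def approxCoeff (q : ℕ) (t : ℂ) : Option (Option (Fin q)) → ℂ
  | none => t⁻¹ ^ 3 - q * t⁻¹ ^ 2
  | some none => -t⁻¹ ^ 3
  | some (some _) => t⁻¹ ^ 2

/-- The vectors whose cubes occur in `littleCW_approx`. -/
noncomputable def approxVector (q : ℕ) (t : ℂ) : Option (Option (Fin q)) → Fin (q + 1) → ℂ
  | none => e 0
  | some none => e 0 + t ^ 2 • ∑ j : Fin q, e j.succ
  | some (some j) => e 0 + t • e j.succ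

/-- In powers of the `e j.succ`, the coefficients are chosen so that the terms of degree 0 and 1
cancel exactly. Degree 2 gives `littleCW q` with an error of order `t`, and degree 3 only
contributes to `R` and `S`. -/
theorem littleCW_approx (q : ℕ) :
    ∃ R S : (Fin (q + 1) → ℂ) ⊗[ℂ] (Fin (q + 1) → ℂ) ⊗[ℂ] (Fin (q + 1) → ℂ), ∀ t : ℂ, t ≠ 0 →
      ∑ i, (approxCoeff q t i • approxVector q t i) ⊗ₜ[ℂ] approxVector q t i ⊗ₜ[ℂ]
        approxVector q t i = littleCW q + t • R + t ^ 3 • S := by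
  have cube : ∀ (c s : ℂ) (u v : Fin (q + 1) → ℂ),
      (c • (u + s • v)) ⊗ₜ[ℂ] (u + s • v) ⊗ₜ[ℂ] (u + s • v) =
        c • (u ⊗ₜ[ℂ] u ⊗ₜ[ℂ] u) +
        (c * s) • (u ⊗ₜ[ℂ] u ⊗ₜ[ℂ] v + u ⊗ₜ[ℂ] v ⊗ₜ[ℂ] u + v ⊗ₜ[ℂ] u ⊗ₜ[ℂ] u) +
        (c * s ^ 2) • (u ⊗ₜ[ℂ] v ⊗ₜ[ℂ] v + v ⊗ₜ[ℂ] u ⊗ₜ[ℂ] v + v ⊗ₜ[ℂ] v ⊗ₜ[ℂ] u) +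
        (c * s ^ 3) • (v ⊗ₜ[ℂ] v ⊗ₜ[ℂ] v) := by
    intro c s u v
    simp only [TensorProduct.add_tmul, TensorProduct.tmul_add, ← TensorProduct.smul_tmul',
      TensorProduct.tmul_smul, smul_add, smul_smul]
    module
  set f : Fin (q + 1) → ℂ := ∑ j : Fin q, e j.succ with hf
  refine ⟨∑ j : Fin q, e j.succ ⊗ₜ[ℂ] e j.succ ⊗ₜ[ℂ] e j.succ +
    (-1 : ℂ) • (e 0 ⊗ₜ[ℂ] f ⊗ₜ[ℂ] f + f ⊗ₜ[ℂ] e 0 ⊗ₜ[ℂ] f + f ⊗ₜ[ℂ] f ⊗ₜ[ℂ] e 0),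
    (-1 : ℂ) • (f ⊗ₜ[ℂ] f ⊗ₜ[ℂ] f), fun t ht => ?_⟩
  have h1 : t⁻¹ ^ 2 * t = t⁻¹ := by field_simp
  have h2 : t⁻¹ ^ 2 * t ^ 2 = 1 := by field_simp
  have h3 : t⁻¹ ^ 2 * t ^ 3 = t := by field_simp
  have h4 : -t⁻¹ ^ 3 * t ^ 2 = -t⁻¹ := by field_simp
  have h5 : -t⁻¹ ^ 3 * (t ^ 2) ^ 2 = -t := by field_simp
  have h6 : -t⁻¹ ^ 3 * (t ^ 2) ^ 3 = -t ^ 3 := by field_simp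
  simp only [Fintype.sum_option, approxCoeff, approxVector, cube, h1, h2, h3, h4, h5, h6]
  simp only [Finset.sum_add_distrib, ← Finset.smul_sum, Finset.sum_const, Finset.card_univ,
    Fintype.card_fin, ← TensorProduct.smul_tmul', one_smul, littleCW,
    ← Nat.cast_smul_eq_nsmul ℂ, ← TensorProduct.tmul_sum, ← TensorProduct.sum_tmul, ← hf]
  module

theorem borderRank_kronecker_littleCW_le (q : ℕ) :
    borderRank (kronecker (littleCW q) (littleCW q)) ≤ (q + 2) ^ 2 := by
  obtain ⟨R, S, hRS⟩ := littleCW_approx q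
  have key := borderRank_kronecker_self_le (littleCW q)
    (fun m i => approxCoeff q (1 / ((m : ℂ) + 1)) i • approxVector q (1 / ((m : ℂ) + 1)) i)
    (fun m i => approxVector q (1 / ((m : ℂ) + 1)) i)
    (fun m i => approxVector q (1 / ((m : ℂ) + 1)) i) ?_
  · simpa using key
  · let _ : TopologicalSpace ((Fin (q + 1) → ℂ) ⊗[ℂ] (Fin (q + 1) → ℂ) ⊗[ℂ] (Fin (q + 1) → ℂ)) :=
      moduleTopology ℂ _
    have : IsModuleTopology ℂ
      ((Fin (q + 1) → ℂ) ⊗[ℂ] (Fin (q + 1) → ℂ) ⊗[ℂ] (Fin (q + 1) → ℂ)) := ⟨rfl⟩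
    have := IsModuleTopology.toContinuousAdd ℂ
      ((Fin (q + 1) → ℂ) ⊗[ℂ] (Fin (q + 1) → ℂ) ⊗[ℂ] (Fin (q + 1) → ℂ))
    have ht : Filter.Tendsto (fun m : ℕ => 1 / ((m : ℂ) + 1)) Filter.atTop (nhds 0) :=
      tendsto_one_div_add_atTop_nhds_zero_nat
    have hne : ∀ m : ℕ, 1 / ((m : ℂ) + 1) ≠ 0 := fun m =>
      one_div_ne_zero (Nat.cast_add_one_ne_zero m)
    simp only [fun m => hRS _ (hne m)]
    have hlim := ((tendsto_const_nhds (x := littleCW q)).add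
      (ht.smul (tendsto_const_nhds (x := R)))).add
      ((ht.pow 3).smul (tendsto_const_nhds (x := S)))
    simpa using hlim

/-! ### Product functionals and Koszul flattenings over `ℂ⁵` -/

section Functionals

variable {A B C : Type*}
  [AddCommGroup A] [Module ℂ A] [AddCommGroup B] [Module ℂ B] [AddCommGroup C] [Module ℂ C]

/-- The product of two linear functionals, as a functional on the tensor product. -/
noncomputable def pairing (f : A →ₗ[ℂ] ℂ) (g : B →ₗ[ℂ] ℂ) : A ⊗[ℂ] B →ₗ[ℂ] ℂ :=
  LinearMap.mul' ℂ ℂ ∘ₗ TensorProduct.map f g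

@[simp]
theorem pairing_tmul (f : A →ₗ[ℂ] ℂ) (g : B →ₗ[ℂ] ℂ) (a : A) (b : B) :
    pairing f g (a ⊗ₜ[ℂ] b) = f a * g b := by
  simp [pairing]

end Functionals

section Koszul

/-- The functional `x ↦ x ∧ v₁ ∧ v₂ ∧ v₃ ∧ v₄` on `ℂ⁵`. -/
noncomputable def wedge (v₁ v₂ v₃ v₄ : Fin 5 → ℂ) : (Fin 5 → ℂ) →ₗ[ℂ] ℂ :=
  (Matrix.detRowAlternating (n := Fin 5) (R := ℂ)).toMultilinearMap.toLinearMap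
    ![0, v₁, v₂, v₃, v₄] 0

theorem wedge_apply (v₁ v₂ v₃ v₄ x : Fin 5 → ℂ) :
    wedge v₁ v₂ v₃ v₄ x = (Pi.basisFun ℂ (Fin 5)).det ![x, v₁, v₂, v₃, v₄] := by
  rw [Pi.basisFun_det]
  exact congrArg (Matrix.detRowAlternating (n := Fin 5) (R := ℂ))
    (Fin.update_cons_zero (α := fun _ : Fin 5 => Fin 5 → ℂ) 0 ![v₁, v₂, v₃, v₄] x)

/-- Laplace expansion of the remaining 4×4 determinant along two pairs of rows. Its six products of
2×2 minors are the source of the constant 6. -/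
theorem det_single_zero (w₁ w₂ w₃ w₄ : Fin 5 → ℂ) :
    Matrix.det (Matrix.of ![Pi.single (0 : Fin 5) (1 : ℂ), w₁, w₂, w₃, w₄]) =
      (w₁ 1 * w₂ 2 - w₁ 2 * w₂ 1) * (w₃ 3 * w₄ 4 - w₃ 4 * w₄ 3) -
      (w₁ 1 * w₂ 3 - w₁ 3 * w₂ 1) * (w₃ 2 * w₄ 4 - w₃ 4 * w₄ 2) +
      (w₁ 1 * w₂ 4 - w₁ 4 * w₂ 1) * (w₃ 2 * w₄ 3 - w₃ 3 * w₄ 2) +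
      (w₁ 2 * w₂ 3 - w₁ 3 * w₂ 2) * (w₃ 1 * w₄ 4 - w₃ 4 * w₄ 1) -
      (w₁ 2 * w₂ 4 - w₁ 4 * w₂ 2) * (w₃ 1 * w₄ 3 - w₃ 3 * w₄ 1) +
      (w₁ 3 * w₂ 4 - w₁ 4 * w₂ 3) * (w₃ 1 * w₄ 2 - w₃ 2 * w₄ 1) := by
  rw [Matrix.det_succ_row_zero, Finset.sum_eq_single 0 (by
    intro j _ hj
    simp [Pi.single_eq_of_ne hj]) (by simp)]
  simp [Matrix.det_succ_row_zero, Fin.sum_univ_succ, Fin.succAbove]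
  ring

/-- Wedging with a fixed vector `x ∈ ℂ⁵` has rank at most six as a bilinear form on `Λ²ℂ⁵`. -/
theorem exists_wedge_eq_sum (x : Fin 5 → ℂ) :
    ∃ f g : (Fin 5 → ℂ) → (Fin 5 → ℂ) → Fin 6 → ℂ, ∀ v₁ v₂ v₃ v₄,
      wedge v₁ v₂ v₃ v₄ x = ∑ k, f v₁ v₂ k * g v₃ v₄ k := by
  by_cases hx : x = 0
  · refine ⟨fun _ _ _ => 0, fun _ _ _ => 0, fun v₁ v₂ v₃ v₄ => ?_⟩
    rw [hx, LinearMap.map_zero]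
    simp
  -- An automorphism moving `x` to the first basis vector only scales the determinant by `d`, which
  -- reduces to `det_single_zero`.
  obtain ⟨h, hh⟩ := SeparatingDual.exists_continuousLinearEquiv_apply_eq (R := ℂ) hx
    (y := Pi.single (0 : Fin 5) (1 : ℂ)) (by simp)
  have hdet : LinearMap.det (h.toLinearEquiv : (Fin 5 → ℂ) →ₗ[ℂ] (Fin 5 → ℂ)) ≠ 0 :=
    (LinearEquiv.isUnit_det' h.toLinearEquiv).ne_zero
  set d := LinearMap.det (h.toLinearEquiv : (Fin 5 → ℂ) →ₗ[ℂ] (Fin 5 → ℂ)) with hd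
  let p : Fin 5 → Fin 5 → (Fin 5 → ℂ) → (Fin 5 → ℂ) → ℂ := fun a b v w =>
    h v a * h w b - h v b * h w a
  refine ⟨fun v w => ![p 1 2 v w, -p 1 3 v w, p 1 4 v w, p 2 3 v w, -p 2 4 v w, p 3 4 v w],
    fun v w k => d⁻¹ * ![p 3 4 v w, p 2 4 v w, p 2 3 v w, p 1 4 v w, p 1 3 v w, p 1 2 v w] k,
    fun v₁ v₂ v₃ v₄ => ?_⟩
  have key : d * wedge v₁ v₂ v₃ v₄ x =
      Matrix.det (Matrix.of ![Pi.single (0 : Fin 5) (1 : ℂ), h v₁, h v₂, h v₃, h v₄]) := by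
    have hcomp : (h.toLinearEquiv : (Fin 5 → ℂ) →ₗ[ℂ] (Fin 5 → ℂ)) ∘ ![x, v₁, v₂, v₃, v₄] =
        ![h x, h v₁, h v₂, h v₃, h v₄] := by
      funext i
      fin_cases i <;> rfl
    rw [wedge_apply, hd, ← Module.Basis.det_comp, hcomp, hh, Pi.basisFun_det_apply]
  rw [det_single_zero] at key
  rw [eq_comm, ← mul_right_inj' hdet, key]
  simp only [Fin.sum_univ_six, p]
  simp
  field_simp
  ring

/-- In a kernel vector, take a nonzero coordinate `s` of least `ρ`: row `s` reduces to `M s s * v s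
= 0`. Since `ρ` need not be injective, blocks can share the same range of positions. -/
theorem det_ne_zero_of_triangular {S : Type*} [Fintype S] [DecidableEq S] (M : Matrix S S ℂ)
    (ρ : S → ℕ) (hdiag : ∀ s, M s s ≠ 0) (hzero : ∀ s t, s ≠ t → ρ s ≤ ρ t → M s t = 0) :
    M.det ≠ 0 := by
  intro hM
  obtain ⟨v, hv, hMv⟩ := Matrix.exists_mulVec_eq_zero_iff.mpr hM
  have hne : (Finset.univ.filter fun s => v s ≠ 0).Nonempty := by
    obtain ⟨s, hs⟩ := Function.ne_iff.mp hv
    exact ⟨s, by simpa using hs⟩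
  obtain ⟨s, hs, hmin⟩ := Finset.exists_min_image _ ρ hne
  have hsum : ∑ t, M s t * v t = 0 := congrFun hMv s
  rw [Finset.sum_eq_single s] at hsum
  · exact (mul_ne_zero (hdiag s) (by simpa using hs)) hsum
  · intro t _ hts
    by_cases ht : v t = 0
    · rw [ht, mul_zero]
    · rw [hzero s t hts.symm (hmin t (by simpa using ht)), zero_mul]
  · simp

variable {A B C : Type*}
  [AddCommGroup A] [Module ℂ A] [AddCommGroup B] [Module ℂ B] [AddCommGroup C] [Module ℂ C]

/-- A square submatrix of the Koszul flattening `Λ²ℂ⁵ ⊗ B* → Λ³ℂ⁵ ⊗ C` of the image of `T` under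
`φ : A → ℂ⁵`. Rows are indexed by `v s ∧ v' s ⊗ β s`, and columns by `w t ∧ w' t ⊗ γ t`. -/
noncomputable def flattening {S : Type*} (φ : A →ₗ[ℂ] (Fin 5 → ℂ)) (v v' w w' : S → Fin 5 → ℂ)
    (β : S → B →ₗ[ℂ] ℂ) (γ : S → C →ₗ[ℂ] ℂ) (T : A ⊗[ℂ] B ⊗[ℂ] C) : Matrix S S ℂ :=
  Matrix.of fun s t =>
    pairing (pairing (wedge (v s) (v' s) (w t) (w' t) ∘ₗ φ) (β s)) (γ t) T

variable {S : Type*} [Fintype S] [DecidableEq S] (φ : A →ₗ[ℂ] (Fin 5 → ℂ))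
  (v v' w w' : S → Fin 5 → ℂ) (β : S → B →ₗ[ℂ] ℂ) (γ : S → C →ₗ[ℂ] ℂ)

/-- Each simple summand contributes rank at most six by `exists_wedge_eq_sum`, so the matrix factors
through a space of dimension `6 * tensorRank T`. -/
theorem det_flattening_eq_zero (T : A ⊗[ℂ] B ⊗[ℂ] C) (hT : 6 * tensorRank T < Fintype.card S) :
    (flattening φ v v' w w' β γ T).det = 0 := by
  obtain ⟨x, y, z, h⟩ := isSumOfSimple_tensorRank T
  choose f g hfg using fun l => exists_wedge_eq_sum (φ (x l))
  have hmul : flattening φ v v' w w' β γ T =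
      (Matrix.of fun s (p : Fin (tensorRank T) × Fin 6) =>
        f p.1 (v s) (v' s) p.2 * β s (y p.1)) *
      (Matrix.of fun (p : Fin (tensorRank T) × Fin 6) t =>
        g p.1 (w t) (w' t) p.2 * γ t (z p.1)) := by
    ext s t
    have : flattening φ v v' w w' β γ T s t =
        ∑ l, wedge (v s) (v' s) (w t) (w' t) (φ (x l)) * β s (y l) * γ t (z l) := by
      rw [flattening, Matrix.of_apply]
      conv_lhs => rw [h]
      simp
    rw [this, Matrix.mul_apply, Fintype.sum_prod_type]
    refine Finset.sum_congr rfl fun l _ => ?_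
    rw [hfg, Finset.sum_mul, Finset.sum_mul]
    refine Finset.sum_congr rfl fun k _ => ?_
    simp only [Matrix.of_apply]
    ring
  by_contra hdet
  have h1 := Matrix.rank_of_isUnit _ ((Matrix.isUnit_iff_isUnit_det _).mpr (Ne.isUnit hdet))
  have h2 : (flattening φ v v' w w' β γ T).rank ≤ tensorRank T * 6 := by
    rw [hmul]
    refine (Matrix.rank_mul_le_left _ _).trans ((Matrix.rank_le_card_width _).trans ?_)
    simp
  omega

/-- The lower bound for border rank given by the Koszul flattening. -/
theorem card_le_of_det_flattening_ne_zero (T : A ⊗[ℂ] B ⊗[ℂ] C)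
    (hT : (flattening φ v v' w w' β γ T).det ≠ 0) : Fintype.card S ≤ 6 * borderRank T := by
  by_contra! hlt
  obtain ⟨t, ht, hlim⟩ := isLimitOfRankLE_borderRank T
  let _ : TopologicalSpace (A ⊗[ℂ] B ⊗[ℂ] C) := moduleTopology ℂ _
  have : IsModuleTopology ℂ (A ⊗[ℂ] B ⊗[ℂ] C) := ⟨rfl⟩
  have hcont : Continuous fun U => (flattening φ v v' w w' β γ U).det := by
    refine Continuous.matrix_det (continuous_matrix fun s t => ?_)
    exact IsModuleTopology.continuous_of_linearMap
      (pairing (pairing (wedge (v s) (v' s) (w t) (w' t) ∘ₗ φ) (β s)) (γ t))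
  have hzero : ∀ m, (flattening φ v v' w w' β γ (t m)).det = 0 := fun m =>
    det_flattening_eq_zero φ v v' w w' β γ (t m) (by have := ht m; omega)
  have hlim' := (hcont.tendsto T).comp hlim
  simp only [Function.comp_def, hzero] at hlim'
  exact hT (tendsto_nhds_unique hlim' tendsto_const_nhds)

end Koszul

/-! ### Slices of the tensor and of its Kronecker square -/

section Slices

variable {q : ℕ}

/-- The linear functional `x ↦ x b` on `ℂ^(q+1)`, zero if the index is out of range. -/
noncomputable def coord (q b : ℕ) : (Fin (q + 1) → ℂ) →ₗ[ℂ] ℂ :=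
  if h : b < q + 1 then LinearMap.proj ⟨b, h⟩ else 0

theorem coord_e {b : ℕ} (a : Fin (q + 1)) : coord q b (e a) = if (a : ℕ) = b then 1 else 0 := by
  by_cases h : b < q + 1
  · simp [coord, h, e, Pi.single_apply, Fin.ext_iff, eq_comm]
  · have : (a : ℕ) ≠ b := by omega
    simp [coord, h, this]

theorem coord_e_zero {b : ℕ} :
    coord q b (e (0 : Fin (q + 1))) = if 0 = b then 1 else 0 := coord_e 0

theorem coord_e_succ {b : ℕ} (j : Fin q) :
    coord q b (e j.succ) = if (j : ℕ) + 1 = b then 1 else 0 := coord_e j.succ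

/-- The index `a` for which `e a ⊗ e b ⊗ e c` occurs in the little Coppersmith–Winograd tensor. If
there is none, an index that is at least `4`. -/
def slot (b c : ℕ) : ℕ :=
  if b = c then (if b = 0 then 4 else 0) else if b = 0 then c else if c = 0 then b else 4

/-- A slice has at most one nonzero coordinate. As `x` vanishes from `4` on, the default value `4`
of `slot` correctly gives zero when there is none. -/
theorem pairing_littleCW (α : (Fin (q + 1) → ℂ) →ₗ[ℂ] ℂ) (x : ℕ → ℂ)
    (hα : ∀ a : Fin (q + 1), α (e a) = x a) (hx : ∀ a, 4 ≤ a → x a = 0) {b c : ℕ}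
    (hb : b < q + 1) (hc : c < q + 1) :
    pairing (pairing α (coord q b)) (coord q c) (littleCW q) = x (slot b c) := by
  have hval : pairing (pairing α (coord q b)) (coord q c) (littleCW q) =
      ∑ j : Fin q, (x 0 * (if (j : ℕ) + 1 = b then 1 else 0) * (if (j : ℕ) + 1 = c then 1 else 0) +
        x (j + 1) * (if 0 = b then 1 else 0) * (if (j : ℕ) + 1 = c then 1 else 0) +
        x (j + 1) * (if (j : ℕ) + 1 = b then 1 else 0) * (if 0 = c then 1 else 0)) := by
    simp only [littleCW, map_sum, map_add, pairing_tmul, coord_e_zero, coord_e_succ, hα,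
      Fin.val_succ, Fin.val_zero]
  rw [hval]
  rcases b with _ | b
  · rcases c with _ | c
    · simp [slot, hx]
    · obtain ⟨c, rfl⟩ : ∃ c' : Fin q, (c' : ℕ) = c := ⟨⟨c, by omega⟩, rfl⟩
      simp [slot, Fin.val_inj]
  · obtain ⟨b, rfl⟩ : ∃ b' : Fin q, (b' : ℕ) = b := ⟨⟨b, by omega⟩, rfl⟩
    rcases c with _ | c
    · simp [slot, Fin.val_inj]
    · obtain ⟨c, rfl⟩ : ∃ c' : Fin q, (c' : ℕ) = c := ⟨⟨c, by omega⟩, rfl⟩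
      by_cases hbc : b = c
      · simp [slot, Fin.val_inj, hbc]
      · have hcb : (b : ℕ) ≠ c := fun h => hbc (Fin.ext h)
        simp [slot, Fin.val_inj, Ne.symm hbc, hcb, hx]

/-- Slices of a Kronecker product are computed one factor at a time. -/
theorem exists_pairing_kronecker {A B C A' B' C' : Type*}
    [AddCommGroup A] [Module ℂ A] [AddCommGroup B] [Module ℂ B] [AddCommGroup C] [Module ℂ C]
    [AddCommGroup A'] [Module ℂ A'] [AddCommGroup B'] [Module ℂ B'] [AddCommGroup C'] [Module ℂ C']
    (α : A ⊗[ℂ] A' →ₗ[ℂ] ℂ) (β : B →ₗ[ℂ] ℂ) (β' : B' →ₗ[ℂ] ℂ) (γ : C →ₗ[ℂ] ℂ)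
    (γ' : C' →ₗ[ℂ] ℂ) (T : A ⊗[ℂ] B ⊗[ℂ] C) (S : A' ⊗[ℂ] B' ⊗[ℂ] C') :
    ∃ α' : A →ₗ[ℂ] ℂ,
      (∀ a, α' a = pairing (pairing (α ∘ₗ TensorProduct.mk ℂ A A' a) β') γ' S) ∧
      pairing (pairing α (pairing β β')) (pairing γ γ') (kronecker T S) =
        pairing (pairing α' β) γ T := by
  obtain ⟨r, x, y, z, rfl⟩ := exists_isSumOfSimple T
  obtain ⟨r', x', y', z', rfl⟩ := exists_isSumOfSimple S
  -- `α'` is `α` with its second argument contracted against the slice of `S` at `β'`, `γ'`.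
  refine ⟨∑ j, (β' (y' j) * γ' (z' j)) • (α ∘ₗ (TensorProduct.mk ℂ A A').flip (x' j)), ?_, ?_⟩
  · intro a
    simp only [LinearMap.sum_apply, LinearMap.smul_apply, map_sum, pairing_tmul,
      LinearMap.comp_apply, LinearMap.flip_apply, TensorProduct.mk_apply, smul_eq_mul]
    exact Finset.sum_congr rfl fun j _ => by ring
  · simp only [← kroneckerBilin_apply, map_sum, LinearMap.sum_apply, Finset.sum_mul,
      pairing_tmul, LinearMap.smul_apply, LinearMap.comp_apply, LinearMap.flip_apply,
      TensorProduct.mk_apply, smul_eq_mul]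
    rw [Finset.sum_comm]
    refine Finset.sum_congr rfl fun i _ => Finset.sum_congr rfl fun j _ => ?_
    simp only [kroneckerBilin_apply, kronecker_tmul, pairing_tmul]
    ring

end Slices

/-! ### The projection to `ℂ⁵` and the finite list of pivots -/

section Pivots

/-- The image of `e a ⊗ e a'` under the projection to `ℂ⁵` is the basis vector of this index, and
zero if the index is `5`. -/
def colour : ℕ → ℕ → ℕ
  | 0, 0 => 0 | 1, 3 => 0
  | 0, 2 => 1 | 1, 1 => 1 | 2, 3 => 1 | 3, 2 => 1
  | 0, 3 => 2 | 1, 2 => 2 | 2, 0 => 2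
  | 0, 1 => 3 | 2, 2 => 3 | 3, 0 => 3 | 3, 3 => 3
  | 1, 0 => 4 | 3, 1 => 4
  | _, _ => 5

theorem colour_of_le {a a' : ℕ} (h : 4 ≤ a ∨ 4 ≤ a') : colour a a' = 5 := by
  unfold colour
  split <;> omega

/-- The basis vector of `ℂ⁵` of index `n`, zero if the index is out of range. -/
def unit (n : ℕ) : Fin 5 → ℂ := fun k => if (k : ℕ) = n then 1 else 0

/-- The projection `ℂ^(q+1) ⊗ ℂ^(q+1) → ℂ⁵` given by `colour`. -/
noncomputable def project (q : ℕ) : (Fin (q + 1) → ℂ) ⊗[ℂ] (Fin (q + 1) → ℂ) →ₗ[ℂ] (Fin 5 → ℂ) :=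
  ∑ a : Fin (q + 1), ∑ a' : Fin (q + 1),
    (pairing (coord q a) (coord q a')).smulRight (unit (colour a a'))

theorem project_e {q : ℕ} (a a' : Fin (q + 1)) :
    project q (e a ⊗ₜ[ℂ] e a') = unit (colour a a') := by
  simp [project, coord_e, Fin.val_inj, LinearMap.sum_apply]

theorem unit_of_le {n : ℕ} (h : 5 ≤ n) : unit n = 0 := by
  funext k
  have : (k : ℕ) ≠ n := by omega
  simp [unit, this]

/-- The entries of the Koszul flattening of the Kronecker square. -/
theorem pairing_kronecker_littleCW {q : ℕ} (ω : (Fin 5 → ℂ) →ₗ[ℂ] ℂ) {b b' c c' : ℕ}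
    (hb : b < q + 1) (hb' : b' < q + 1) (hc : c < q + 1) (hc' : c' < q + 1) :
    pairing (pairing (ω ∘ₗ project q) (pairing (coord q b) (coord q b')))
        (pairing (coord q c) (coord q c')) (kronecker (littleCW q) (littleCW q)) =
      ω (unit (colour (slot b c) (slot b' c'))) := by
  obtain ⟨α', hα', h⟩ := exists_pairing_kronecker (ω ∘ₗ project q) (coord q b) (coord q b')
    (coord q c) (coord q c') (littleCW q) (littleCW q)
  rw [h]
  refine pairing_littleCW α' (fun a => ω (unit (colour a (slot b' c')))) (fun a => ?_)
    (fun a ha => ?_) hb hc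
  · rw [hα']
    refine pairing_littleCW _ (fun a' => ω (unit (colour a a'))) (fun a' => ?_)
      (fun a' ha' => ?_) hb' hc'
    · simp [project_e]
    · rw [colour_of_le (Or.inr ha'), unit_of_le le_rfl, map_zero]
  · rw [colour_of_le (Or.inl ha), unit_of_le le_rfl, map_zero]

theorem wedge_unit_eq_zero {m i j k l : ℕ} (h : ¬[m, i, j, k, l].Nodup) :
    wedge (unit i) (unit j) (unit k) (unit l) (unit m) = 0 := by
  have hvec : ![unit m, unit i, unit j, unit k, unit l] = unit ∘ ![m, i, j, k, l] := by
    funext r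
    fin_cases r <;> rfl
  have hinj : ¬Function.Injective ![m, i, j, k, l] := by
    rw [← List.nodup_ofFn]
    simpa [List.ofFn_succ] using h
  obtain ⟨r, s, hrs, hne⟩ := Function.not_injective_iff.mp hinj
  rw [wedge_apply, hvec]
  exact AlternatingMap.map_eq_zero_of_eq _ _ (congrArg unit hrs) hne

/-- Five distinct indices below `5` form a permutation of the basis, so the determinant is its sign.
-/
theorem wedge_unit_ne_zero {m i j k l : ℕ} (h : [m, i, j, k, l].Nodup)
    (hlt : ∀ n ∈ [m, i, j, k, l], n < 5) :
    wedge (unit i) (unit j) (unit k) (unit l) (unit m) ≠ 0 := by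
  have hinj : Function.Injective ![m, i, j, k, l] := by
    rw [← List.nodup_ofFn]
    simpa [List.ofFn_succ] using h
  have hlt' : ∀ r, ![m, i, j, k, l] r < 5 := by
    simp only [List.mem_cons, forall_eq_or_imp] at hlt
    intro r
    fin_cases r <;> simp [hlt]
  let σ : Fin 5 → Fin 5 := fun r => ⟨![m, i, j, k, l] r, hlt' r⟩
  have hσ : Function.Injective σ := fun r s hrs => hinj (congrArg Fin.val hrs)
  let τ : Equiv.Perm (Fin 5) := Equiv.ofBijective σ (Finite.injective_iff_bijective.mp hσ)
  have hvec : ![unit m, unit i, unit j, unit k, unit l] = Pi.basisFun ℂ (Fin 5) ∘ τ := by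
    have hr : ∀ r, unit (![m, i, j, k, l] r) = Pi.basisFun ℂ (Fin 5) (τ r) := by
      intro r
      funext s
      simp [unit, τ, σ, Pi.single_apply, Fin.ext_iff]
    funext r
    rw [Function.comp_apply, ← hr]
    fin_cases r <;> rfl
  rw [wedge_apply, hvec, AlternatingMap.map_perm, Module.Basis.det_self]
  rcases Int.units_eq_one_or (Equiv.Perm.sign τ) with h1 | h1 <;> simp [h1]

/-- The decimal digit of `n` at position `k`. -/
def digit (n k : ℕ) : ℕ := n / 10 ^ k % 10

/-- The Boolean test for `a ≠ b`. -/
def apart (a b : ℕ) : Bool := !Nat.beq a b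

theorem apart_eq_true {a b : ℕ} : apart a b = true ↔ a ≠ b := by
  rw [apart, Bool.not_eq_true', ← Bool.not_eq_true, Nat.beq_eq]

/-- An index `i j b b' k l c c'` of eight digits stands for the row `e i ∧ e j ⊗ e b ⊗ e b'`
together with the column `e k ∧ e l ⊗ e c ⊗ e c'`. Whether the flattening is nonzero at the row of
`n` and the column of `m`, where a digit `4` in place of `b`, `b'`, `c`, `c'` stands for one fixed
index that is at least `4`. -/
def support (n m : ℕ) : Bool :=
  let c := colour (slot (digit n 5) (digit m 1)) (slot (digit n 4) (digit m 0))
  apart (digit n 7) (digit m 3) && apart (digit n 7) (digit m 2) &&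
  apart (digit n 6) (digit m 3) && apart (digit n 6) (digit m 2) && Nat.blt c 5 &&
  apart c (digit n 7) && apart c (digit n 6) && apart c (digit m 3) && apart c (digit m 2)

/-- The test `support` does not compare the two wedge indices of the row with each other, nor those
of the column; the hypotheses supply these comparisons. -/
theorem support_eq_true {n m : ℕ} (hn : digit n 7 ≠ digit n 6) (hm : digit m 3 ≠ digit m 2) :
    support n m = true ↔
      colour (slot (digit n 5) (digit m 1)) (slot (digit n 4) (digit m 0)) < 5 ∧
      [colour (slot (digit n 5) (digit m 1)) (slot (digit n 4) (digit m 0)),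
        digit n 7, digit n 6, digit m 3, digit m 2].Nodup := by
  simp only [support, Bool.and_eq_true, apart_eq_true, Nat.blt_eq, List.nodup_cons, List.mem_cons,
    List.not_mem_nil, or_false, not_or, List.nodup_nil, not_false_eq_true, and_true]
  tauto

/-- Pivots of the flattening, in triangular order: for both `b` and `b'` below `4`, for `b'`
large, for `b` large, for both large. -/
def pivots : Bool → Bool → List ℕ
  | false, false => [13322432, 01322402, 03311200, 13200423, 02131303, 34311231, 03331430, 02211420, 02233400,
    03211401, 01122302, 23331433, 12233423, 23211421, 04131310, 01202421, 02311300, 04122310,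
    03301201, 24131313, 04011321, 03112400, 03231403, 04311230, 02033420, 02221400, 01233403,
    03322430, 01223402, 12100411, 02203422, 03222420, 02323430, 12220400, 01332403, 01213401,
    23231423, 03202422, 13220402, 12200421, 12323432, 03031213, 34130110, 14322332, 13122412,
    01032313, 13330430, 23321432, 02021312, 24120310, 24010131, 14132300, 01312401, 03101413,
    23000432, 23300101, 34211221, 23130103, 23111411, 02103412, 01002331, 12120302, 14310201,
    13300433, 13112411, 13010211, 03131410, 02111301, 04331330, 02301431, 04301333, 24330100,
    02121302, 12030313, 14102303, 02011311, 01022312, 24110300, 24231323, 03011211, 34110200,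
    01112301, 03121202, 04202322, 13312431, 01303433, 12330403, 13230420, 23200422, 23030113,
    13020410, 03001412, 34100102, 04222320, 04031233, 34330130, 23010111, 12020312, 24100301,
    23221422, 24311331, 12113411, 03021212, 12213421, 34120210, 14112311, 04322330, 04211220,
    34321232, 04021322, 34010121, 01103413, 24220320, 24030133, 12130303, 24200322, 14232323,
    34300232, 14020220, 34221222, 34020122, 12300431, 04111210, 24300332, 12010330, 24000323,
    24210120, 34030123, 23020112, 14030233, 13210401, 14000222, 34200203, 23100412, 34231223,
    24020132, 34000223, 13132413, 13000231, 12313431, 14300333, 14010321, 14332333, 14200221,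
    13030213, 24321332, 13100413, 14212321, 12000331, 04231320]
  | false, true => [24141314, 01243404, 04341204, 02141304, 34341234, 12243424, 02041434, 34141214, 34040124,
    02341404, 14142314, 13342434, 03041424, 24241324, 13240404, 24340104, 23040114, 34241224,
    14040234, 12343434, 13040424, 01142304, 14242324, 14342334, 13142414, 12143414, 23141414,
    01342404, 24040134, 12040434]
  | true, false => [04431340, 24431343, 03431440, 23431443, 03402442, 04411240, 14422342, 02423440, 12423442,
    23411441, 13400443, 04401241, 04422340, 03422440, 13412441, 12433443, 14412341, 24421342,
    14432343, 13432443, 23421442, 24400342, 12400441, 12413441, 34400242, 14400241, 24410140,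
    34431243, 23400442, 34421242]
  | true, true => [12443444, 13442444, 14442344, 23441444, 24441344, 34441244]

theorem length_pivots : (pivots false false).length = 150 ∧ (pivots false true).length = 30 ∧
    (pivots true false).length = 30 ∧ (pivots true true).length = 6 := by
  decide +kernel

/-- The triangularity certificate: the row of an earlier pivot vanishes at the column of every later
one. -/
theorem pairwise_pivots (x y : Bool) : (pivots x y).Pairwise fun n m => support n m = false := by
  revert x y
  decide +kernel

theorem forall_mem_pivots (x y : Bool) : ∀ n ∈ pivots x y, support n n = true ∧
    digit n 7 ≠ digit n 6 ∧ digit n 3 ≠ digit n 2 ∧ (∀ k ∈ [2, 3, 6, 7], digit n k < 5) ∧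
    (∀ k ∈ [1, 5], digit n k ≤ 4 ∧ (digit n k = 4 ↔ x = true)) ∧
    (∀ k ∈ [0, 4], digit n k ≤ 4 ∧ (digit n k = 4 ↔ y = true)) := by
  revert x y
  decide +kernel

end Pivots

/-! ### Block decomposition and the lower bound -/

section LowerBound

/-- The index of a basis vector in block `x`: the given index if `x = none`, and the index `i + 4`
if `x = some i`. -/
def blockIndex {w : ℕ} (x : Option (Fin w)) (d : ℕ) : ℕ := x.elim d fun i => i + 4

theorem blockIndex_lt {w d : ℕ} {x : Option (Fin w)} (hd : d ≤ 4)
    (h : d = 4 ↔ x.isSome = true) : blockIndex x d < w + 3 + 1 := by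
  cases x with
  | none =>
    simp only [Option.isSome_none, Bool.false_eq_true, iff_false] at h
    simp only [blockIndex, Option.elim]
    omega
  | some i =>
    simp only [blockIndex, Option.elim]
    omega

/-- Within a block the large indices coincide, so the digit `4` stands for all of them and the
entries do not depend on which large index it is. -/
theorem slot_blockIndex {w d d' : ℕ} {x : Option (Fin w)} (h : d = 4 ↔ x.isSome = true)
    (h' : d' = 4 ↔ x.isSome = true) : slot (blockIndex x d) (blockIndex x d') = slot d d' := by
  cases x with
  | none => rfl
  | some i =>
    simp only [Option.isSome_some, iff_true] at h h'
    simp [blockIndex, slot, h, h']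

theorem le_slot {b c : ℕ} (h : b ≠ c) (h4 : 4 ≤ b ∨ 4 ≤ c) : 4 ≤ slot b c := by
  unfold slot
  split_ifs <;> omega

/-- Indices from different blocks differ and at least one is large, so the first factor of the slice
is absent or is itself killed by the projection. This makes the off-diagonal blocks vanish. -/
theorem le_slot_blockIndex {w d d' : ℕ} {x x' : Option (Fin w)} (hx : x ≠ x') (hd : d ≤ 4)
    (hd' : d' ≤ 4) (h : d = 4 ↔ x.isSome = true) (h' : d' = 4 ↔ x'.isSome = true) :
    4 ≤ slot (blockIndex x d) (blockIndex x' d') := by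
  rcases x with _ | i <;> rcases x' with _ | i'
  · exact absurd rfl hx
  · have hd4 : d ≠ 4 := by simpa using h
    refine le_slot ?_ (Or.inr ?_) <;> simp only [blockIndex, Option.elim] <;> omega
  · have hd4 : d' ≠ 4 := by simpa using h'
    refine le_slot ?_ (Or.inl ?_) <;> simp only [blockIndex, Option.elim] <;> omega
  · have hne : (i : ℕ) ≠ i' := fun hii' => hx (congrArg some (Fin.ext hii'))
    refine le_slot ?_ (Or.inl ?_) <;> simp only [blockIndex, Option.elim] <;> omega

/-- The rows and columns of the triangular submatrix, grouped into blocks. -/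
abbrev PivotIndex (w : ℕ) : Type :=
  Σ p : Option (Fin w) × Option (Fin w), Fin (pivots p.1.isSome p.2.isSome).length

/-- The digits encoding the row and the column of a pivot. -/
def PivotIndex.code {w : ℕ} (s : PivotIndex w) : ℕ := (pivots s.1.1.isSome s.1.2.isSome)[s.2]

theorem card_pivotIndex (w : ℕ) : Fintype.card (PivotIndex w) = 6 * (w + 5) ^ 2 := by
  obtain ⟨h₁, h₂, h₃, h₄⟩ := length_pivots
  simp only [Fintype.card_sigma, Fintype.card_fin, Fintype.sum_prod_type, Fintype.sum_option,
    Option.isSome_none, Option.isSome_some, h₁, h₂, h₃, h₄, Finset.sum_const, Finset.card_univ,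
    smul_eq_mul]
  ring

theorem PivotIndex.code_spec {w : ℕ} (s : PivotIndex w) : support s.code s.code = true ∧
    digit s.code 7 ≠ digit s.code 6 ∧ digit s.code 3 ≠ digit s.code 2 ∧
    (∀ k ∈ [2, 3, 6, 7], digit s.code k < 5) ∧
    (∀ k ∈ [1, 5], digit s.code k ≤ 4 ∧ (digit s.code k = 4 ↔ s.1.1.isSome = true)) ∧
    (∀ k ∈ [0, 4], digit s.code k ≤ 4 ∧ (digit s.code k = 4 ↔ s.1.2.isSome = true)) :=
  forall_mem_pivots _ _ _ (List.getElem_mem _)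

theorem PivotIndex.support_eq_false {w : ℕ} {s t : PivotIndex w} (hst : s ≠ t) (h : s.1 = t.1)
    (hle : (s.2 : ℕ) ≤ t.2) : support s.code t.code = false := by
  obtain ⟨p, s⟩ := s
  obtain ⟨p', t⟩ := t
  obtain rfl : p = p' := h
  have hlt : (s : ℕ) < t := lt_of_le_of_ne hle fun h => hst (by rw [Fin.ext h])
  exact List.pairwise_iff_getElem.mp (pairwise_pivots p.1.isSome p.2.isSome) s t s.2 t.2 hlt

/-- The triangular submatrix of the Koszul flattening of the Kronecker square. -/
noncomputable def pivotMatrix (w : ℕ) : Matrix (PivotIndex w) (PivotIndex w) ℂ :=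
  flattening (project (w + 3)) (fun s => unit (digit s.code 7)) (fun s => unit (digit s.code 6))
    (fun t => unit (digit t.code 3)) (fun t => unit (digit t.code 2))
    (fun s => pairing (coord (w + 3) (blockIndex s.1.1 (digit s.code 5)))
      (coord (w + 3) (blockIndex s.1.2 (digit s.code 4))))
    (fun t => pairing (coord (w + 3) (blockIndex t.1.1 (digit t.code 1)))
      (coord (w + 3) (blockIndex t.1.2 (digit t.code 0))))
    (kronecker (littleCW (w + 3)) (littleCW (w + 3)))

theorem pivotMatrix_apply {w : ℕ} (s t : PivotIndex w) :
    pivotMatrix w s t = wedge (unit (digit s.code 7)) (unit (digit s.code 6))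
      (unit (digit t.code 3)) (unit (digit t.code 2))
      (unit (colour (slot (blockIndex s.1.1 (digit s.code 5)) (blockIndex t.1.1 (digit t.code 1)))
        (slot (blockIndex s.1.2 (digit s.code 4)) (blockIndex t.1.2 (digit t.code 0))))) := by
  obtain ⟨-, -, -, -, hs₁, hs₂⟩ := s.code_spec
  obtain ⟨-, -, -, -, ht₁, ht₂⟩ := t.code_spec
  rw [pivotMatrix, flattening, Matrix.of_apply]
  exact pairing_kronecker_littleCW _
    (blockIndex_lt (hs₁ 5 (by simp)).1 (hs₁ 5 (by simp)).2)
    (blockIndex_lt (hs₂ 4 (by simp)).1 (hs₂ 4 (by simp)).2)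
    (blockIndex_lt (ht₁ 1 (by simp)).1 (ht₁ 1 (by simp)).2)
    (blockIndex_lt (ht₂ 0 (by simp)).1 (ht₂ 0 (by simp)).2)

theorem pivotMatrix_apply_of_eq {w : ℕ} {s t : PivotIndex w} (h : s.1 = t.1) :
    pivotMatrix w s t = wedge (unit (digit s.code 7)) (unit (digit s.code 6))
      (unit (digit t.code 3)) (unit (digit t.code 2))
      (unit (colour (slot (digit s.code 5) (digit t.code 1))
        (slot (digit s.code 4) (digit t.code 0)))) := by
  obtain ⟨-, -, -, -, hs₁, hs₂⟩ := s.code_spec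
  obtain ⟨-, -, -, -, ht₁, ht₂⟩ := t.code_spec
  rw [← h] at ht₁ ht₂
  rw [pivotMatrix_apply, ← h, slot_blockIndex (hs₁ 5 (by simp)).2 (ht₁ 1 (by simp)).2,
    slot_blockIndex (hs₂ 4 (by simp)).2 (ht₂ 0 (by simp)).2]

theorem det_pivotMatrix_ne_zero (w : ℕ) : (pivotMatrix w).det ≠ 0 := by
  -- The position inside the block suffices as `ρ`, since entries between different blocks vanish in
  -- both directions.
  refine det_ne_zero_of_triangular _ (fun s => (s.2 : ℕ)) (fun s => ?_) fun s t hst hle => ?_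
  · obtain ⟨hs, hs₇, hs₃, hlt, -, -⟩ := s.code_spec
    rw [support_eq_true hs₇ hs₃] at hs
    rw [pivotMatrix_apply_of_eq rfl]
    refine wedge_unit_ne_zero hs.2 ?_
    simp only [List.mem_cons, List.not_mem_nil, or_false, forall_eq_or_imp, forall_eq] at hlt ⊢
    exact ⟨hs.1, hlt.2.2.2, hlt.2.2.1, hlt.2.1, hlt.1⟩
  · by_cases h : s.1 = t.1
    · have hs := PivotIndex.support_eq_false hst h hle
      rw [pivotMatrix_apply_of_eq h]
      rw [← Bool.not_eq_true, support_eq_true s.code_spec.2.1 t.code_spec.2.2.1, not_and_or,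
        not_lt] at hs
      rcases hs with hs | hs
      · rw [unit_of_le hs, map_zero]
      · exact wedge_unit_eq_zero hs
    · obtain ⟨-, -, -, -, hs₁, hs₂⟩ := s.code_spec
      obtain ⟨-, -, -, -, ht₁, ht₂⟩ := t.code_spec
      rw [pivotMatrix_apply, colour_of_le, unit_of_le le_rfl, map_zero]
      by_cases h₁ : s.1.1 = t.1.1
      · have h₂ : s.1.2 ≠ t.1.2 := fun h₂ => h (Prod.ext h₁ h₂)
        exact Or.inr (le_slot_blockIndex h₂ (hs₂ 4 (by simp)).1 (ht₂ 0 (by simp)).1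
          (hs₂ 4 (by simp)).2 (ht₂ 0 (by simp)).2)
      · exact Or.inl (le_slot_blockIndex h₁ (hs₁ 5 (by simp)).1 (ht₁ 1 (by simp)).1
          (hs₁ 5 (by simp)).2 (ht₁ 1 (by simp)).2)

theorem le_borderRank_kronecker_littleCW (w : ℕ) :
    (w + 5) ^ 2 ≤ borderRank (kronecker (littleCW (w + 3)) (littleCW (w + 3))) := by
  have h := card_le_of_det_flattening_ne_zero _ _ _ _ _ _ _ _ (det_pivotMatrix_ne_zero w)
  rw [card_pivotIndex] at h
  omega

end LowerBound

end BorderRank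

theorem theorem3p1 (q : ℕ) (hq : 3 ≤ q) :
    BorderRank.borderRank
      (BorderRank.kronecker (BorderRank.littleCW q) (BorderRank.littleCW q)) = (q + 2) ^ 2 := by
  -- `w` counts the large indices `4, …, q`; the pivots use all of the indices `0, …, 3`, hence `q ≥
  -- 3`.
  obtain ⟨w, rfl⟩ := Nat.exists_eq_add_of_le' hq
  exact le_antisymm (BorderRank.borderRank_kronecker_littleCW_le _)
    (BorderRank.le_borderRank_kronecker_littleCW w)
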